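/- All spaces are separable and metrizable. A space is called analytic if it is empty or a continuous image of $\mathbb N^{\mathbb N}$ (equivalently, homeomorphic to an analytic subset of a Polish space), and zero-dimensional if it has a basis of clopen sets (so the empty space is zero-dimensional). For a space $X$ let $\mathcal F(X)$ be the set of all closed subsets of $X$ and $\mathcal F_0(X)\subseteq\mathcal F(X)$ the set of those that are zero-dimensional. An admissible topology on $\mathcal F(X)$ is one obtained by embedding $X$ (not necessarily densely) in a compact metrizable space $\hat X$ and identifying $F\in\mathcal F(X)$ with its closure $\overline F$ in $\hat X$, viewed as a point of the hyperspace of all compact subsets of $\hat X$ with the Vietoris topology. A subset $B$ of a topological space $T$ is $\Pi^1_1$ in $T$ if $T\setminus B$ is analytic (empty or a continuous image of $\mathbb N^{\mathbb N}$). It is $\Pi^1_1$-hard if for every $\Pi^1_1$ set $A\subseteq 2^{\mathbb N}$ there is a continuous map $\varphi:2^{\mathbb N}\to T$ with $A=\varphi^{-1}(B)$, and $\Pi^1_1$-complete if it is both $\Pi^1_1$ in $T$ and $\Pi^1_1$-hard. **Theorem.** Let $Y$ be a space that is not zero-dimensional, let $Z$ be a zero-dimensional analytic space that is not $\sigma$-compact,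 and let $\mathcal F(Y\times Z)$ carry any admissible topology. 1. If $Y$ is analytic, then $\mathcal F_0(Y\times Z)$ is a $\Pi^1_1$-hard subset of $\mathcal F(Y\times Z)$. 2. If $Y$ is $\sigma$-compact, then $\mathcal F_0(Y\times Z)$ is a $\Pi^1_1$-complete subset of $\mathcal F(Y\times Z)$. -/

import Mathlib

open Set Topology TopologicalSpace MeasureTheory

universe u v w

/-- A space is zero-dimensional if it has a basis of clopen sets, that is, if its dimension is
at most `0`; the empty space counts as zero-dimensional. (For separable metrizable spaces
the small inductive dimension agrees with the other dimension functions.) -/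
def ZeroDimensional (X : Type u) [TopologicalSpace X] : Prop :=
  HasSmallInductiveDimensionLE X 0

/-- `X` is an analytic space: it is empty or a continuous image of the Baire space `ℕ → ℕ`.
It is used for separable metrizable spaces `X`, where it says that `X` is homeomorphic to an
analytic subset of a Polish space. -/
def AnalyticSpace (X : Type u) [TopologicalSpace X] : Prop :=
  AnalyticSet (univ : Set X)

/-- For `i : X → K` with `K` compact, the map sending a closed subset `F` of `X` to the closure
of `i '' F` in `K`, as a point of the hyperspace of compact subsets of `K`. -/
def closureIn {X : Type u} [TopologicalSpace X] {K : Type w} [TopologicalSpace K]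
    [CompactSpace K] (i : X → K) (F : Closeds X) : Compacts K :=
  ⟨closure (i '' (F : Set X)), isClosed_closure.isCompact⟩

/-- The topology on the hyperspace of all closed subsets of `X` obtained by identifying a closed
subset of `X` with its closure in the compact space `K`, where the hyperspace `Compacts K`
carries the Vietoris topology. -/
abbrev hyperspaceTopology {X : Type u} [TopologicalSpace X] {K : Type w} [TopologicalSpace K]
    [CompactSpace K] (i : X → K) : TopologicalSpace (Closeds X) :=
  TopologicalSpace.induced (closureIn i) (inferInstance : TopologicalSpace (Compacts K))

/-- A topology on the hyperspace of closed subsets of `X` is admissible if it comes from some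
embedding (not necessarily dense) of `X` in a compact metrizable space. -/
def IsAdmissible (X : Type u) [TopologicalSpace X] [t : TopologicalSpace (Closeds X)] : Prop :=
  ∃ (K : Type w) (_ : TopologicalSpace K) (_ : CompactSpace K) (_ : MetrizableSpace K)
    (i : X → K), IsEmbedding i ∧ t = hyperspaceTopology i

/-- The set of all closed zero-dimensional subsets of `X`. -/
def closedZeroDim (X : Type u) [TopologicalSpace X] : Set (Closeds X) :=
  {F | ZeroDimensional (F : Set X)}

/-- `A` is coanalytic (`Π¹₁`) in the ambient space `T`: its complement in `T` is analytic. -/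
def IsCoanalytic {T : Type u} [TopologicalSpace T] (A : Set T) : Prop :=
  AnalyticSet Aᶜ

/-- `A ⊆ S` is reducible to `B ⊆ T` if it is the preimage of `B` under a continuous map. -/
def IsReducible {S : Type u} {T : Type v} [TopologicalSpace S] [TopologicalSpace T]
    (A : Set S) (B : Set T) : Prop :=
  ∃ φ : S → T, Continuous φ ∧ A = φ ⁻¹' B

/-- `B` is `Π¹₁`-hard: every coanalytic subset of the Cantor space is reducible to `B`. -/
def IsCoanalyticHard {T : Type u} [TopologicalSpace T] (B : Set T) : Prop :=
  ∀ A : Set (ℕ → Bool), IsCoanalytic A → IsReducible A B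

/-- `B` is `Π¹₁`-complete: it is coanalytic and `Π¹₁`-hard. -/
def IsCoanalyticComplete {T : Type u} [TopologicalSpace T] (B : Set T) : Prop :=
  IsCoanalytic B ∧ IsCoanalyticHard B

/-! Hardness. If `Aᶜ` is the range of a continuous `f`, the attempts to solve `f c = x` form a tree
which has an infinite branch iff `x ∉ A`. A Hurewicz-type argument (`exists_isClopenScheme`) gives a
locally finite clopen scheme in `Z` whose branches all have nonempty intersection. Pulled back to `Y
× Z`, it turns a tree into the closed set of points on its branches together with a countable net. A
branch contributes a whole copy `Y × {z}` of `Y`, which destroys zero-dimensionality; without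
branches only the countable net is left, and it is zero-dimensional. The net also gives continuity:
it approximates deep nodes and children of large index so well that finitely many nodes of the tree
determine the closure in `K` up to `ε`.

Upper bound. Let `Y` be the union of compact sets `Q n`. By the countable closed sum theorem, and
because projecting a closed subset of `Q n × Z` to `Z` is proper, a closed `F` fails to be
zero-dimensional iff some `F ∩ (Q n × {z})` contains a nontrivial continuum
(`not_zeroDimensional_iff_exists_continuum`). The triples of `F`, a code for `z` and a continuum,
together with a dense sequence in `F`, are coded by Borel subsets of Polish spaces, and their
continuous images make up the complement of `closedZeroDim`. -/

/-! ### Zero-dimensional spaces: partitions and separation -/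

theorem zeroDimensional_iff_exists_isClopen {X : Type u} [TopologicalSpace X] :
    ZeroDimensional X ↔ ∀ (x : X) (U : Set X), IsOpen U → x ∈ U →
      ∃ V, IsClopen V ∧ x ∈ V ∧ V ⊆ U := by
  rw [ZeroDimensional, HasSmallInductiveDimensionLE, zero_add,
    hasSmallInductiveDimensionLT_one_iff]
  constructor
  · intro h x U hU hx
    obtain ⟨V, hV, hxV, hVU⟩ := h.exists_subset_of_mem_open hx hU
    exact ⟨V, hV, hxV, hVU⟩
  · intro h
    refine isTopologicalBasis_of_isOpen_of_nhds (fun U hU => hU.isOpen) fun x U hx hU => ?_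
    obtain ⟨V, hV, hxV, hVU⟩ := h x U hU hx
    exact ⟨V, hV, hxV, hVU⟩

theorem ZeroDimensional.of_isInducing {X : Type u} {Y : Type v} [TopologicalSpace X]
    [TopologicalSpace Y] (hY : ZeroDimensional Y) {f : X → Y} (hf : IsInducing f) :
    ZeroDimensional X := by
  rw [zeroDimensional_iff_exists_isClopen] at hY ⊢
  intro x U hU hx
  obtain ⟨O, hO, rfl⟩ := hf.isOpen_iff.1 hU
  obtain ⟨V, hV, hxV, hVO⟩ := hY (f x) O hO hx
  exact ⟨f ⁻¹' V, hV.preimage hf.continuous, hxV, preimage_mono hVO⟩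

theorem ZeroDimensional.of_subsingleton {X : Type u} [TopologicalSpace X] [Subsingleton X] :
    ZeroDimensional X := by
  rw [zeroDimensional_iff_exists_isClopen]
  exact fun x U _ hx => ⟨univ, isClopen_univ, mem_univ x,
    fun y _ => Subsingleton.elim x y ▸ hx⟩

/-- In a zero-dimensional Lindelöf space every open cover has a disjoint clopen refinement indexed
by the natural numbers. -/
theorem ZeroDimensional.exists_clopen_partition {X : Type u} [TopologicalSpace X]
    [SecondCountableTopology X] [Nonempty X] (hX : ZeroDimensional X) (U : X → Set X)
    (hU : ∀ x, IsOpen (U x)) (hxU : ∀ x, x ∈ U x) :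
    ∃ C : ℕ → Set X, (∀ n, IsClopen (C n)) ∧ Pairwise (Function.onFun Disjoint C) ∧
      (⋃ n, C n) = univ ∧ ∀ n, ∃ x, C n ⊆ U x := by
  rw [zeroDimensional_iff_exists_isClopen] at hX
  choose V hV hxV hVU using fun x => hX x (U x) (hU x) (hxU x)
  obtain ⟨s, hs, hsV⟩ := TopologicalSpace.countable_cover_nhds fun x => (hV x).isOpen.mem_nhds (hxV x)
  have hne : s.Nonempty := by
    by_contra h
    rw [not_nonempty_iff_eq_empty] at h
    simp only [h, mem_empty_iff_false, iUnion_of_empty, iUnion_empty] at hsV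
    exact empty_ne_univ hsV
  obtain ⟨e, rfl⟩ := hs.exists_eq_range hne
  rw [biUnion_range] at hsV
  refine ⟨disjointed fun n => V (e n), fun n => ?_, disjoint_disjointed _,
    by rw [iUnion_disjointed, hsV], fun n => ⟨e n, (disjointed_subset _ n).trans (hVU _)⟩⟩
  refine disjointedRec (p := IsClopen) (fun t i ht => ht.diff (hV _)) (hV _)

/-- Partition the space into clopen pieces each of which misses `A` or `B`. The union of the pieces
meeting `A` is clopen, its complement being the union of the others. -/
theorem ZeroDimensional.exists_clopen_separation {X : Type u} [TopologicalSpace X]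
    [SecondCountableTopology X] (hX : ZeroDimensional X) {A B : Set X} (hA : IsClosed A)
    (hB : IsClosed B) (hAB : Disjoint A B) : ∃ C, IsClopen C ∧ A ⊆ C ∧ Disjoint C B := by
  classical
  cases isEmpty_or_nonempty X
  · exact ⟨∅, isClopen_empty, fun x => isEmptyElim x, disjoint_bot_left⟩
  obtain ⟨C, hC, hd, hcov, hsub⟩ := hX.exists_clopen_partition
    (fun x => if x ∈ A then Bᶜ else Aᶜ)
    (fun x => by split_ifs <;> simp [hA, hB])
    (fun x => by
      split_ifs with h
      · exact disjoint_left.1 hAB h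
      · exact h)
  refine ⟨⋃ n : {n // (C n ∩ A).Nonempty}, C n, ?_, ?_, ?_⟩
  · constructor
    · rw [← isOpen_compl_iff]
      have : (⋃ n : {n // (C n ∩ A).Nonempty}, C n)ᶜ = ⋃ n : {n // ¬ (C n ∩ A).Nonempty}, C n := by
        ext x
        have hx : x ∈ ⋃ n, C n := hcov ▸ mem_univ x
        obtain ⟨n, hn⟩ := mem_iUnion.1 hx
        simp only [mem_compl_iff, mem_iUnion, Subtype.exists, exists_prop, not_exists, not_and]
        constructor
        · intro h
          exact ⟨n, fun h' => h n h' hn, hn⟩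
        · rintro ⟨m, hm, hxm⟩ k hk hxk
          rcases eq_or_ne m k with rfl | hmk
          · exact hm hk
          · exact disjoint_left.1 (hd hmk) hxm hxk
      rw [this]
      exact isOpen_iUnion fun n => (hC n).isOpen
    · exact isOpen_iUnion fun n => (hC n).isOpen
  · intro x hx
    obtain ⟨n, hn⟩ := mem_iUnion.1 (hcov ▸ mem_univ x : x ∈ ⋃ n, C n)
    exact mem_iUnion.2 ⟨⟨n, x, hn, hx⟩, hn⟩
  · rw [disjoint_iUnion_left]
    rintro ⟨n, y, hyn, hyA⟩
    obtain ⟨x, hx⟩ := hsub n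
    split_ifs at hx with h
    · exact disjoint_left.2 fun z hz => hx hz
    · exact absurd hyA (hx hyn)

/-! ### The closed sum theorem and proper maps -/

/-- One step of the countable closed sum theorem: two open sets with disjoint closures can be
enlarged so as to cover a closed zero-dimensional set. -/
theorem exists_enlarge_of_zeroDimensional {X : Type u} [TopologicalSpace X]
    [SecondCountableTopology X] [NormalSpace X] {F : Set X} (hF : IsClosed F)
    (hF0 : ZeroDimensional F) {U V : Set X} (hUV : Disjoint (closure U) (closure V)) :
    ∃ U' V', IsOpen U' ∧ IsOpen V' ∧ closure U ⊆ U' ∧ closure V ⊆ V' ∧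
      Disjoint (closure U') (closure V') ∧ F ⊆ U' ∪ V' := by
  obtain ⟨C, hC, hUC, hCV⟩ := hF0.exists_clopen_separation
    (A := (↑) ⁻¹' closure U) (B := (↑) ⁻¹' closure V)
    (isClosed_closure.preimage continuous_subtype_val)
    (isClosed_closure.preimage continuous_subtype_val) (hUV.preimage _)
  have hcl : ∀ {S : Set F}, IsClosed S → IsClosed ((↑) '' S : Set X) := fun hS =>
    hF.isClosedEmbedding_subtypeVal.isClosedMap _ hS
  have hd : Disjoint (closure U ∪ (↑) '' C) (closure V ∪ (↑) '' Cᶜ) := by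
    rw [disjoint_union_left, disjoint_union_right, disjoint_union_right]
    refine ⟨⟨hUV, ?_⟩, ?_, ?_⟩
    · rw [disjoint_left]
      rintro _ hx ⟨y, hy, rfl⟩
      exact hy (hUC hx)
    · rw [disjoint_left]
      rintro _ ⟨y, hy, rfl⟩ hx
      exact disjoint_left.1 hCV hy hx
    · exact disjoint_image_of_injective Subtype.val_injective disjoint_compl_right
  obtain ⟨U₁, hU₁, hsub₁, hd₁⟩ := normal_exists_closure_subset
    (isClosed_closure.union (hcl hC.isClosed))
    (isClosed_closure.union (hcl hC.compl.isClosed)).isOpen_compl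
    (disjoint_left.1 hd)
  obtain ⟨V₁, hV₁, hsub₂, hd₂⟩ := normal_exists_closure_subset
    (isClosed_closure.union (hcl hC.compl.isClosed)) (isClosed_closure (s := U₁)).isOpen_compl
    (fun x hx hx' => hd₁ hx' hx)
  refine ⟨U₁, V₁, hU₁, hV₁, subset_union_left.trans hsub₁, subset_union_left.trans hsub₂,
    (disjoint_left.2 fun x hx => hd₂ hx).symm, fun x hx => ?_⟩
  by_cases h : (⟨x, hx⟩ : F) ∈ C
  · exact Or.inl (hsub₁ (Or.inr ⟨_, h, rfl⟩))
  · exact Or.inr (hsub₂ (Or.inr ⟨_, h, rfl⟩))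

/-- The countable closed sum theorem in dimension zero. -/
theorem ZeroDimensional.of_iUnion_isClosed {X : Type u} [TopologicalSpace X]
    [SecondCountableTopology X] [T4Space X] (F : ℕ → Set X) (hF : ∀ n, IsClosed (F n))
    (hF0 : ∀ n, ZeroDimensional (F n)) (hcov : (⋃ n, F n) = univ) : ZeroDimensional X := by
  rw [zeroDimensional_iff_exists_isClopen]
  intro x O hO hx
  -- Start with neighbourhoods of `x` and of `Oᶜ`, and enlarge the pair so that the `n`-th step
  -- swallows `F n`. In the limit the two unions are open, disjoint and cover `X`, so the first is
  -- clopen.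
  let S := {p : Set X × Set X // IsOpen p.1 ∧ IsOpen p.2 ∧ Disjoint (closure p.1) (closure p.2)}
  obtain ⟨U₀, hU₀, hxU₀, hd₀⟩ := normal_exists_closure_subset (isClosed_singleton (x := x)) hO
    (singleton_subset_iff.2 hx)
  obtain ⟨V₀, hV₀, hOV₀, hd₀'⟩ := normal_exists_closure_subset hO.isClosed_compl
    (isClosed_closure (s := U₀)).isOpen_compl (compl_subset_compl.2 hd₀)
  have step : ∀ (n : ℕ) (p : S), ∃ q : S, p.1.1 ⊆ q.1.1 ∧ p.1.2 ⊆ q.1.2 ∧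
      F n ⊆ q.1.1 ∪ q.1.2 := by
    rintro n ⟨⟨U, V⟩, hU, hV, hUV⟩
    obtain ⟨U', V', hU', hV', h1, h2, h3, h4⟩ :=
      exists_enlarge_of_zeroDimensional (hF n) (hF0 n) hUV
    exact ⟨⟨(U', V'), hU', hV', h3⟩, subset_closure.trans h1, subset_closure.trans h2, h4⟩
  choose next h1 h2 h3 using step
  let s : ℕ → S := fun n => Nat.rec
    ⟨(U₀, V₀), hU₀, hV₀, (disjoint_left.2 fun y hy => hd₀' hy).symm⟩ next n
  have m1 : Monotone fun n => (s n).1.1 := monotone_nat_of_le_succ fun n => h1 n (s n)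
  have m2 : Monotone fun n => (s n).1.2 := monotone_nat_of_le_succ fun n => h2 n (s n)
  have hd : Disjoint (⋃ n, (s n).1.1) (⋃ n, (s n).1.2) := by
    rw [disjoint_left]
    intro y hy hy'
    obtain ⟨n, hn⟩ := mem_iUnion.1 hy
    obtain ⟨m, hm⟩ := mem_iUnion.1 hy'
    exact disjoint_left.1 (s (max n m)).2.2.2 (subset_closure (m1 (le_max_left n m) hn))
      (subset_closure (m2 (le_max_right n m) hm))
  have hc : (⋃ n, (s n).1.1)ᶜ = ⋃ n, (s n).1.2 := by
    refine Subset.antisymm (fun y hy => ?_) hd.symm.subset_compl_right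
    obtain ⟨n, hn⟩ := mem_iUnion.1 (hcov ▸ mem_univ y : y ∈ ⋃ n, F n)
    rcases h3 n (s n) hn with h | h
    · exact absurd (mem_iUnion.2 ⟨n + 1, h⟩) hy
    · exact mem_iUnion.2 ⟨n + 1, h⟩
  refine ⟨⋃ n, (s n).1.1, ⟨?_, isOpen_iUnion fun n => (s n).2.1⟩,
    mem_iUnion.2 ⟨0, hxU₀ rfl⟩, fun y hy => ?_⟩
  · rw [← isOpen_compl_iff, hc]
    exact isOpen_iUnion fun n => (s n).2.2.1
  · by_contra hyO
    exact disjoint_left.1 hd hy (mem_iUnion.2 ⟨0, hOV₀ hyO⟩)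

theorem ZeroDimensional.of_countable {X : Type u} [TopologicalSpace X] [MetrizableSpace X]
    [Countable X] : ZeroDimensional X := by
  cases isEmpty_or_nonempty X
  · exact .of_subsingleton
  let := metrizableSpaceMetric X
  obtain ⟨e, he⟩ := exists_surjective_nat X
  have : SecondCountableTopology X := UniformSpace.secondCountable_of_separable X
  exact .of_iUnion_isClosed (fun n => {e n}) (fun n => isClosed_singleton)
    (fun n => .of_subsingleton) (by simpa [iUnion_singleton_eq_range] using he.range_eq)

/-- A space that maps properly to a zero-dimensional space with totally disconnected fibres is
zero-dimensional. -/
theorem ZeroDimensional.of_isProperMap {X : Type u} {Z : Type v} [TopologicalSpace X] [T2Space X]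
    [TopologicalSpace Z] [T1Space Z] (hZ : ZeroDimensional Z) {p : X → Z} (hp : IsProperMap p)
    (hfib : ∀ z, IsTotallyDisconnected (p ⁻¹' {z})) : ZeroDimensional X := by
  rw [zeroDimensional_iff_exists_isClopen] at hZ ⊢
  intro x U hU hx
  set P := p ⁻¹' {p x} with hP
  have hPc : IsCompact P := hp.isCompact_preimage isCompact_singleton
  have : CompactSpace P := isCompact_iff_compactSpace.1 hPc
  have : TotallyDisconnectedSpace P := totallyDisconnectedSpace_subtype_iff.2 (hfib _)
  obtain ⟨V, hV, hxV, hVU⟩ := compact_exists_isClopen_in_isOpen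
    (hU.preimage (continuous_subtype_val (p := (· ∈ P)))) (x := ⟨x, rfl⟩) hx
  have hc1 : IsCompact ((↑) '' V : Set X) := hV.isClosed.isCompact.image continuous_subtype_val
  have hc2 : IsCompact ((↑) '' Vᶜ : Set X) :=
    hV.compl.isClosed.isCompact.image continuous_subtype_val
  obtain ⟨A, B, hA, hB, hVA, hVB, hAB⟩ := SeparatedNhds.of_isCompact_isCompact hc1 hc2
    (disjoint_image_of_injective Subtype.val_injective disjoint_compl_right)
  -- Tube argument: as `p` is closed, some clopen `W` around `p x` has its preimage inside `(A ∩ U)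
  -- ∪ B`. Over `W` the sets `A ∩ U` and `B` are complementary, hence clopen.
  have hcl : IsClosed (p '' ((A ∩ U) ∪ B)ᶜ) :=
    hp.isClosedMap _ ((hA.inter hU).union hB).isClosed_compl
  obtain ⟨W, hW, hxW, hWsub⟩ := hZ (p x) _ hcl.isOpen_compl (by
    rintro ⟨y, hy, hyx⟩
    apply hy
    by_cases h : (⟨y, hyx⟩ : P) ∈ V
    · exact Or.inl ⟨hVA ⟨_, h, rfl⟩, hVU h⟩
    · exact Or.inr (hVB ⟨_, h, rfl⟩))
  have hpW := hW.preimage hp.continuous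
  have hcov : ∀ y, p y ∈ W → y ∈ (A ∩ U) ∪ B := fun y hy => by
    by_contra h
    exact hWsub hy ⟨y, h, rfl⟩
  refine ⟨(A ∩ U) ∩ p ⁻¹' W, ⟨?_, (hA.inter hU).inter hpW.isOpen⟩,
    ⟨⟨hVA ⟨_, hxV, rfl⟩, hx⟩, hxW⟩, fun y hy => hy.1.2⟩
  have : ((A ∩ U) ∩ p ⁻¹' W) = p ⁻¹' W ∩ Bᶜ := by
    ext y
    constructor
    · rintro ⟨⟨h1, -⟩, h2⟩
      exact ⟨h2, disjoint_left.1 hAB h1⟩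
    · rintro ⟨h1, h2⟩
      exact ⟨(hcov y h1).resolve_right h2, h1⟩
  rw [this]
  exact hpW.isClosed.inter hB.isClosed_compl

/-! ### Hurewicz schemes in spaces that are not `σ`-compact -/

/-- A set is `σ`-bounded if it is contained in a `σ`-compact set. -/
def SigmaBounded {Z : Type u} [TopologicalSpace Z] (S : Set Z) : Prop :=
  ∃ K, IsSigmaCompact K ∧ S ⊆ K

theorem SigmaBounded.mono {Z : Type u} [TopologicalSpace Z] {S T : Set Z} (hT : SigmaBounded T)
    (h : S ⊆ T) : SigmaBounded S :=
  let ⟨K, hK, hTK⟩ := hT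
  ⟨K, hK, h.trans hTK⟩

theorem SigmaBounded.iUnion {Z : Type u} [TopologicalSpace Z] {ι : Type v} [Countable ι]
    {S : ι → Set Z} (h : ∀ i, SigmaBounded (S i)) : SigmaBounded (⋃ i, S i) := by
  choose K hK hSK using h
  exact ⟨⋃ i, K i, isSigmaCompact_iUnion K hK, iUnion_mono hSK⟩

theorem IsCompact.sigmaBounded {Z : Type u} [TopologicalSpace Z] {S : Set Z} (h : IsCompact S) :
    SigmaBounded S :=
  ⟨S, h.isSigmaCompact, Subset.rfl⟩

/-- The points all of whose neighbourhoods meet `S` in a set that is not `σ`-bounded do not form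
a compact set unless `S` is `σ`-bounded. -/
theorem not_isCompact_of_not_sigmaBounded {Z : Type u} [TopologicalSpace Z]
    [SecondCountableTopology Z] {S : Set Z} (hS : ¬ SigmaBounded S) :
    ¬ IsCompact {p | ∀ O ∈ 𝓝 p, ¬ SigmaBounded (S ∩ O)} := by
  intro hc
  set B := {p | ∀ O ∈ 𝓝 p, ¬ SigmaBounded (S ∩ O)} with hB
  have : ∀ p ∈ Bᶜ, ∃ O ∈ 𝓝 p, SigmaBounded (S ∩ O) := fun p hp => by
    simpa [hB] using hp
  choose! O hO hSO using this
  obtain ⟨t, htB, ht, hcov⟩ := TopologicalSpace.countable_cover_nhdsWithin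
    (s := Bᶜ) (f := O) fun p hp => mem_nhdsWithin_of_mem_nhds (hO p hp)
  have := ht.to_subtype
  -- The index `none` stands for `B`, which would be one more `σ`-bounded piece if it were compact.
  refine hS ((SigmaBounded.iUnion (ι := Option t)
    (S := fun o => o.elim B fun p => S ∩ O p) ?_).mono ?_)
  · rintro (_ | p)
    · exact hc.sigmaBounded
    · exact hSO _ (htB p.2)
  · intro x hx
    by_cases hxB : x ∈ B
    · exact mem_iUnion.2 ⟨none, hxB⟩
    · obtain ⟨p, hp, hxp⟩ := mem_iUnion₂.1 (hcov hxB)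
      exact mem_iUnion.2 ⟨some ⟨p, hp⟩, hx, hxp⟩

/-- The closed set `B` of points where `S` is nowhere locally `σ`-bounded is not compact, so it has
an open cover without finite subcover. In a clopen partition refining this cover and `Bᶜ`,
infinitely many pieces meet `B`, and each of them is a neighbourhood of a point of `B`. -/
theorem exists_clopen_family_of_not_sigmaBounded {Z : Type u} [TopologicalSpace Z]
    [SecondCountableTopology Z] (hZ : ZeroDimensional Z) {S : Set Z} (hS : ¬ SigmaBounded S) :
    ∃ O : ℕ → Set Z, (∀ n, IsClopen (O n)) ∧ Pairwise (Function.onFun Disjoint O) ∧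
      LocallyFinite O ∧ ∀ n, ¬ SigmaBounded (S ∩ O n) := by
  classical
  have hc := not_isCompact_of_not_sigmaBounded hS
  set B := {p | ∀ O ∈ 𝓝 p, ¬ SigmaBounded (S ∩ O)} with hB
  rw [isCompact_iff_finite_subcover] at hc
  push Not at hc
  obtain ⟨ι, U, hU, hBU, hfin⟩ := hc
  have hne : Nonempty Z := by
    by_contra h
    rw [not_nonempty_iff] at h
    exact hS ((isCompact_empty (X := Z)).sigmaBounded.mono fun x => isEmptyElim x)
  have hBc : IsClosed B := by
    rw [← isOpen_compl_iff, isOpen_iff_mem_nhds]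
    intro p hp
    have : ∃ O ∈ 𝓝 p, SigmaBounded (S ∩ O) := by simpa [hB] using hp
    obtain ⟨O, hO, hSO⟩ := this
    filter_upwards [eventually_mem_nhds_iff.2 hO] with q hq hqB
    exact hqB O hq hSO
  have hx : ∀ x, ∃ V : Set Z, IsOpen V ∧ x ∈ V ∧ ((∃ i, V ⊆ U i) ∨ V ⊆ Bᶜ) := by
    intro x
    by_cases hxB : x ∈ B
    · obtain ⟨i, hi⟩ := mem_iUnion.1 (hBU hxB)
      exact ⟨U i, hU i, hi, Or.inl ⟨i, Subset.rfl⟩⟩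
    · exact ⟨Bᶜ, hBc.isOpen_compl, hxB, Or.inr Subset.rfl⟩
  choose V hV hxV hVU using hx
  obtain ⟨C, hC, hd, hcov, hsub⟩ := hZ.exists_clopen_partition V hV hxV
  have hinf : {n | (C n ∩ B).Nonempty}.Infinite := by
    intro hf
    have hCU : ∀ n, (C n ∩ B).Nonempty → ∃ i, C n ⊆ U i := by
      rintro n ⟨y, hy, hyB⟩
      obtain ⟨x, hx⟩ := hsub n
      rcases hVU x with ⟨i, hi⟩ | h
      · exact ⟨i, hx.trans hi⟩
      · exact absurd hyB (h (hx hy))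
    have : Nonempty ι := by
      by_contra h
      rw [not_nonempty_iff] at h
      exact hfin ∅ (by simpa using hBU)
    choose! i hi using hCU
    refine hfin (hf.toFinset.image i) fun y hy => ?_
    obtain ⟨n, hn⟩ := mem_iUnion.1 (hcov ▸ mem_univ y : y ∈ ⋃ n, C n)
    have hnB : (C n ∩ B).Nonempty := ⟨y, hn, hy⟩
    exact mem_iUnion₂.2 ⟨i n, Finset.mem_image_of_mem _ (hf.mem_toFinset.2 hnB), hi n hnB hn⟩
  have := hinf.to_subtype
  let e := Nat.orderEmbeddingOfSet {n | (C n ∩ B).Nonempty}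
  have he : ∀ n, (C (e n) ∩ B).Nonempty := fun n =>
    (Nat.orderEmbeddingOfSet_range {n | (C n ∩ B).Nonempty}).subset (mem_range_self n)
  have hlf : LocallyFinite C := by
    intro x
    obtain ⟨n, hn⟩ := mem_iUnion.1 (hcov ▸ mem_univ x : x ∈ ⋃ n, C n)
    refine ⟨C n, (hC n).isOpen.mem_nhds hn, (finite_singleton n).subset ?_⟩
    rintro m ⟨y, hym, hyn⟩
    by_contra hmn
    exact disjoint_left.1 (hd hmn) hym hyn
  refine ⟨fun n => C (e n), fun n => hC _, fun m n hmn => hd (e.injective.ne hmn),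
    hlf.comp_injective e.injective, fun n => ?_⟩
  obtain ⟨y, hy, hyB⟩ := he n
  exact hyB _ ((hC _).isOpen.mem_nhds hy)

/-- A scheme of clopen sets that is disjoint and locally finite at each node. -/
structure IsClopenScheme {X : Type u} [TopologicalSpace X] (P : List ℕ → Set X) : Prop where
  isClopen : ∀ s, IsClopen (P s)
  antitone : CantorScheme.Antitone P
  disjoint : CantorScheme.Disjoint P
  locallyFinite : ∀ s, LocallyFinite fun a => P (a :: s)

/-- A form of Hurewicz' theorem: a zero-dimensional analytic space that is not `σ`-compact carries a
locally finite scheme of clopen sets all of whose branches have nonempty intersection. -/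
theorem exists_isClopenScheme {Z : Type u} [TopologicalSpace Z] [MetrizableSpace Z]
    [SeparableSpace Z] (hZ : ZeroDimensional Z) (han : AnalyticSpace Z)
    (hns : ¬ SigmaCompactSpace Z) : ∃ N : List ℕ → Set Z, IsClopenScheme N ∧
      ∀ b : ℕ → ℕ, ∃ z, ∀ k, z ∈ N (PiNat.res b k) := by
  let := metrizableSpaceMetric Z
  have : SecondCountableTopology Z := UniformSpace.secondCountable_of_separable Z
  have huniv : ¬ SigmaBounded (univ : Set Z) := by
    rintro ⟨K, hK, h⟩
    rw [univ_subset_iff.1 h, isSigmaCompact_univ_iff] at hK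
    exact hns hK
  rw [AnalyticSpace, AnalyticSet] at han
  obtain h | ⟨g, hg, hgr⟩ := han
  · exact absurd ((isCompact_empty (X := Z)).sigmaBounded) (h ▸ huniv)
  let cyl : List ℕ → Set (ℕ → ℕ) := fun w => {b | PiNat.res b w.length = w}
  have hcyl : ∀ w, cyl w = ⋃ m, cyl (m :: w) := by
    intro w
    ext b
    simp [cyl]
  -- Besides the clopen set, each node carries an initial segment of a preimage under `g`. Since `Z`
  -- need not be complete, this is what produces a point on every branch.
  let St := {p : List ℕ × Set Z // IsClopen p.2 ∧ ¬ SigmaBounded (g '' cyl p.1 ∩ p.2)}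
  have step : ∀ p : St, ∃ q : ℕ → St, (∀ a, ∃ m, (q a).1.1 = m :: p.1.1) ∧
      (∀ a, (q a).1.2 ⊆ p.1.2) ∧ (Pairwise fun a b => Disjoint (q a).1.2 (q b).1.2) ∧
      LocallyFinite fun a => (q a).1.2 := by
    rintro ⟨⟨w, M⟩, hM, hbig⟩
    obtain ⟨O, hO, hd, hlf, hOS⟩ := exists_clopen_family_of_not_sigmaBounded hZ hbig
    have : ∀ a, ∃ m, ¬ SigmaBounded (g '' cyl (m :: w) ∩ (M ∩ O a)) := by
      intro a
      by_contra! h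
      refine hOS a ((SigmaBounded.iUnion h).mono ?_)
      simp only at *
      rw [hcyl w, image_iUnion, inter_assoc, iUnion_inter]
    choose m hm using this
    refine ⟨fun a => ⟨(m a :: w, M ∩ O a), hM.inter (hO a), hm a⟩, fun a => ⟨m a, rfl⟩,
      fun a => inter_subset_left, fun a b hab => (hd hab).mono inter_subset_right
        inter_subset_right, hlf.subset fun a => inter_subset_right⟩
  choose next h1 h2 h3 h4 using step
  have hinit : ¬ SigmaBounded (g '' cyl [] ∩ univ) := by
    have : cyl [] = univ := by ext; simp [cyl]
    rwa [this, image_univ, hgr, inter_univ]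
  let sch : List ℕ → St := fun s => List.rec (⟨([], univ), isClopen_univ, hinit⟩ : St)
    (fun a s ih => next ih a) s
  have hlen : ∀ s, (sch s).1.1.length = s.length := by
    intro s
    induction s with
    | nil => rfl
    | cons a s ih =>
      obtain ⟨m, hm⟩ := h1 (sch s) a
      change (next (sch s) a).1.1.length = _
      rw [hm, List.length_cons, ih, List.length_cons]
  have hne : ∀ s, (g '' cyl (sch s).1.1 ∩ (sch s).1.2).Nonempty := by
    intro s
    by_contra h
    rw [not_nonempty_iff_eq_empty] at h
    exact (sch s).2.2 (h ▸ isCompact_empty.sigmaBounded)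
  refine ⟨fun s => (sch s).1.2, ⟨fun s => (sch s).2.1, fun s => h2 (sch s),
    fun s a b hab => h3 (sch s) hab, fun s => h4 (sch s)⟩, fun b => ?_⟩
  have hanti : Antitone fun k => (sch (PiNat.res b k)).1.2 :=
    antitone_nat_of_succ_le fun k => h2 (sch (PiNat.res b k)) (b k)
  have hm : ∀ k, ∃ m, (sch (PiNat.res b (k + 1))).1.1 = m :: (sch (PiNat.res b k)).1.1 :=
    fun k => h1 (sch (PiNat.res b k)) (b k)
  choose c hc using hm
  have hres : ∀ k, (sch (PiNat.res b k)).1.1 = PiNat.res c k := by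
    intro k
    induction k with
    | zero => rfl
    | succ k ih => rw [hc, ih, PiNat.res_succ]
  refine ⟨g c, fun k => ?_⟩
  -- The points `v k` of the nodes along `b` have preimages `d k` converging to `c`, so `v k`
  -- converges to `g c`, which therefore lies in every closed node of the branch.
  choose v hv using fun k => hne (PiNat.res b k)
  choose d hd hdv using fun k => (hv k).1
  have hd' : ∀ k, PiNat.res (d k) k = PiNat.res c k := fun k => by
    have := hd k
    simp only [cyl, mem_ofPred_eq, hlen, PiNat.res_length] at this
    rw [this, hres]
  have hlim : Filter.Tendsto d Filter.atTop (𝓝 c) := by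
    rw [tendsto_pi_nhds]
    intro j
    refine tendsto_const_nhds.congr' ?_
    filter_upwards [Filter.eventually_gt_atTop j] with k hk
    exact (PiNat.res_eq_res.1 (hd' k) hk).symm
  refine (sch (PiNat.res b k)).2.1.isClosed.mem_of_tendsto ((hg.tendsto c).comp hlim) ?_
  filter_upwards [Filter.eventually_ge_atTop k] with n hn
  rw [Function.comp_apply, hdv]
  exact hanti hn (hv n).2

/-! ### Closed sets coded by trees -/

/-- The union of the children of the node `s` with index at least `n`. -/
def schemeTail {X : Type u} (P : List ℕ → Set X) (s : List ℕ) (n : ℕ) : Set X :=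
  ⋃ m ≥ n, P (m :: s)

/-- The finite sets `d s n` approximate, with respect to `i`, the tails of the scheme `P`. -/
structure IsSchemeNet {X : Type u} {K : Type v} [PseudoMetricSpace K] (i : X → K)
    (P : List ℕ → Set X) (d : List ℕ → ℕ → Set X) : Prop where
  finite : ∀ s n, (d s n).Finite
  subset_tail : ∀ s n, d s n ⊆ schemeTail P s n
  exists_dist_lt : ∀ s n, ∀ x ∈ schemeTail P s n, ∃ y ∈ d s n,
    dist (i x) (i y) < 1 / (((s.length + n : ℕ) : ℝ) + 1)

/-- Images in `K` are totally bounded. The error tolerance shrinks with both the depth of `s` and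
the index `n`, the two ways in which a node can leave a finite part of the tree. -/
theorem exists_isSchemeNet {X : Type u} {K : Type v} [PseudoMetricSpace K] [CompactSpace K]
    (i : X → K) (P : List ℕ → Set X) : ∃ d, IsSchemeNet i P d := by
  have : ∀ s n, ∃ d : Set X, d ⊆ schemeTail P s n ∧ d.Finite ∧
      i '' schemeTail P s n ⊆
        ⋃ y ∈ i '' d, Metric.ball y (1 / (((s.length + n : ℕ) : ℝ) + 1)) := fun s n => by
    have := Metric.finite_approx_of_totallyBounded
      (isCompact_univ.totallyBounded.subset (subset_univ (i '' schemeTail P s n)))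
      (1 / (((s.length + n : ℕ) : ℝ) + 1)) Nat.one_div_pos_of_nat
    exact exists_subset_image_finite_and.1 this
  choose d h1 h2 h3 using this
  refine ⟨d, h2, h1, fun s n x hx => ?_⟩
  obtain ⟨_, ⟨y, hy, rfl⟩, hxy⟩ := mem_iUnion₂.1 (h3 s n (mem_image_of_mem i hx))
  exact ⟨y, hy, hxy⟩

/-- A set of lists is a tree if it contains the empty list and is closed under removing the last
entry, which is the head of the list. -/
structure IsListTree (T : Set (List ℕ)) : Prop where
  nil_mem : [] ∈ T
  of_cons : ∀ a s, a :: s ∈ T → s ∈ T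

/-- The countable part of the closed set coded by a tree `T`. -/
def treeNet {X : Type u} (d : List ℕ → ℕ → Set X) (T : Set (List ℕ)) : Set X :=
  ⋃ s ∈ T, ⋃ n, d s n

/-- The closed set coded by a tree `T`: the points on the branches of `T`, together with a
countable set. -/
def treeSet {X : Type u} (P : List ℕ → Set X) (d : List ℕ → ℕ → Set X) (T : Set (List ℕ)) :
    Set X :=
  treeNet d T ∪ {x | ∃ b, ∀ k, PiNat.res b k ∈ T ∧ x ∈ P (PiNat.res b k)}

section Scheme

variable {X : Type u} {P : List ℕ → Set X} {d : List ℕ → ℕ → Set X} {T : Set (List ℕ)}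

theorem schemeTail_subset (hP : CantorScheme.Antitone P) (s : List ℕ) (n : ℕ) :
    schemeTail P s n ⊆ P s :=
  iUnion₂_subset fun m _ => hP s m

theorem mem_schemeTail {s : List ℕ} {m n : ℕ} (h : n ≤ m) {x : X} (hx : x ∈ P (m :: s)) :
    x ∈ schemeTail P s n :=
  mem_iUnion₂.2 ⟨m, h, hx⟩

theorem eq_of_mem_of_length_eq (hP : CantorScheme.Antitone P) (hd : CantorScheme.Disjoint P)
    {x : X} : ∀ {s t : List ℕ}, s.length = t.length → x ∈ P s → x ∈ P t → s = t
  | [], [], _, _, _ => rfl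
  | a :: s, b :: t, h, hs, ht => by
    obtain rfl := eq_of_mem_of_length_eq hP hd (by simpa using h) (hP s a hs) (hP t b ht)
    by_contra hne
    exact disjoint_left.1 (hd s fun hab => hne (by rw [hab])) hs ht

theorem exists_ancestor (hP : CantorScheme.Antitone P) (hT : IsListTree T) (k : ℕ) :
    ∀ s ∈ T, k ≤ s.length → ∃ t ∈ T, t.length = k ∧ P s ⊆ P t
  | [], hs, hk => ⟨[], hs, by simpa [eq_comm] using hk, Subset.rfl⟩
  | a :: s, hs, hk => by
    rcases hk.eq_or_lt with h | h
    · exact ⟨a :: s, hs, h.symm, Subset.rfl⟩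
    · obtain ⟨t, ht, htk, hst⟩ := exists_ancestor hP hT k s (hT.of_cons a s hs) (by simpa using h)
      exact ⟨t, ht, htk, (hP s a).trans hst⟩

variable [TopologicalSpace X]

/-- Induction on `k`: near `x` only finitely many nodes of level `k` occur, and a smaller
neighbourhood meets only finitely many children of each. -/
theorem IsClopenScheme.locallyFinite_level (hP : IsClopenScheme P) (k : ℕ) :
    LocallyFinite fun s : {s : List ℕ // s.length = k} => P s := by
  suffices ∀ x, ∃ O ∈ 𝓝 x, {s : List ℕ | s.length = k ∧ (P s ∩ O).Nonempty}.Finite by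
    intro x
    obtain ⟨O, hO, hf⟩ := this x
    refine ⟨O, hO, Finite.of_finite_image (f := Subtype.val) (hf.subset ?_)
      Subtype.val_injective.injOn⟩
    rintro _ ⟨s, hs, rfl⟩
    exact ⟨s.2, hs⟩
  intro x
  induction k with
  | zero =>
    refine ⟨univ, Filter.univ_mem, (finite_singleton []).subset fun s hs => ?_⟩
    exact List.length_eq_zero_iff.1 hs.1
  | succ k ih =>
    obtain ⟨O, hO, hf⟩ := ih
    choose V hV hVf using fun s => hP.locallyFinite s x
    refine ⟨O ∩ ⋂ s ∈ {s : List ℕ | s.length = k ∧ (P s ∩ O).Nonempty}, V s,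
      Filter.inter_mem hO ((Filter.biInter_mem hf).2 fun s _ => hV s),
      (hf.biUnion fun s _ => (hVf s).image (· :: s)).subset ?_⟩
    rintro (_ | ⟨a, s⟩) ⟨hl, y, hy, hyO, hyV⟩
    · simp at hl
    · have hs : s ∈ {s : List ℕ | s.length = k ∧ (P s ∩ O).Nonempty} :=
        ⟨by simpa using hl, y, hP.antitone s a hy, hyO⟩
      exact mem_iUnion₂.2 ⟨s, hs, a, ⟨y, hy, mem_iInter₂.1 hyV s hs⟩, rfl⟩

/-- A neighbourhood that meets no child of index above `m` meets no `d s n` with `n > m`, so the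
finite sets `d s n` are locally finite. -/
theorem IsClopenScheme.isClosed_net [T1Space X] (hP : IsClopenScheme P) {s : List ℕ}
    (hf : ∀ n, (d s n).Finite) (hd : ∀ n, d s n ⊆ schemeTail P s n) :
    IsClosed (⋃ n, d s n) := by
  refine LocallyFinite.isClosed_iUnion (fun x => ?_) fun n => (hf n).isClosed
  obtain ⟨O, hO, hfin⟩ := hP.locallyFinite s x
  refine ⟨O, hO, (hfin.biUnion fun m _ => finite_Iic m).subset ?_⟩
  rintro n ⟨y, hy, hyO⟩
  obtain ⟨m, hm, hym⟩ := mem_iUnion₂.1 (hd n hy)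
  exact mem_iUnion₂.2 ⟨m, ⟨y, hym, hyO⟩, hm⟩

theorem IsClopenScheme.isClosed_treeSet [T1Space X] (hP : IsClopenScheme P)
    (hf : ∀ s n, (d s n).Finite) (hd : ∀ s n, d s n ⊆ schemeTail P s n) (hT : IsListTree T) :
    IsClosed (treeSet P d T) := by
  have hD : ∀ s, (⋃ n, d s n) ⊆ P s := fun s =>
    iUnion_subset fun n => (hd s n).trans (schemeTail_subset hP.antitone s n)
  have hlevel : ∀ (k : ℕ) (Q : List ℕ → Set X), (∀ s, IsClosed (Q s)) → (∀ s, Q s ⊆ P s) →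
      IsClosed (⋃ s ∈ T, ⋃ (_ : s.length = k), Q s) := by
    intro k Q hQ hQP
    have := LocallyFinite.isClosed_iUnion
      (f := fun s : {s : {s : List ℕ // s.length = k} // s.1 ∈ T} => Q s.1)
      ((((hP.locallyFinite_level k).subset fun s => hQP s)).comp_injective Subtype.val_injective)
      fun s => hQ _
    convert this using 1
    ext x
    simp only [mem_iUnion, exists_prop, Subtype.exists]
    exact ⟨fun ⟨s, h1, h2, h3⟩ => ⟨s, h2, h1, h3⟩, fun ⟨s, h2, h1, h3⟩ => ⟨s, h1, h2, h3⟩⟩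
  -- Every set in this intersection is closed by local finiteness of the levels. A point of the
  -- intersection outside the net lies in a node of `T` at each level, and by disjointness these
  -- nodes form a branch.
  have : treeSet P d T = ⋂ k, ((⋃ s ∈ T, ⋃ (_ : s.length = k), P s) ∪
      ⋃ l ∈ Iio k, ⋃ s ∈ T, ⋃ (_ : s.length = l), ⋃ n, d s n) := by
    refine Subset.antisymm ?_ fun x hx => ?_
    · rintro x (hx | ⟨b, hb⟩)
      · obtain ⟨s, hs, hxs⟩ := mem_iUnion₂.1 hx
        refine mem_iInter.2 fun k => ?_
        rcases lt_or_ge s.length k with h | h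
        · exact Or.inr (mem_iUnion₂.2 ⟨_, h, mem_iUnion₂.2 ⟨s, hs, mem_iUnion.2 ⟨rfl, hxs⟩⟩⟩)
        · obtain ⟨t, ht, htk, hst⟩ := exists_ancestor hP.antitone hT k s hs h
          exact Or.inl (mem_iUnion₂.2 ⟨t, ht, mem_iUnion.2 ⟨htk, hst (hD s hxs)⟩⟩)
      · exact mem_iInter.2 fun k => Or.inl (mem_iUnion₂.2
          ⟨_, (hb k).1, mem_iUnion.2 ⟨PiNat.res_length b k, (hb k).2⟩⟩)
    · by_cases hxD : x ∈ treeNet d T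
      · exact Or.inl hxD
      have : ∀ k, ∃ s ∈ T, s.length = k ∧ x ∈ P s := by
        intro k
        rcases mem_iInter.1 hx k with h | h
        · obtain ⟨s, hs, h⟩ := mem_iUnion₂.1 h
          obtain ⟨hl, h⟩ := mem_iUnion.1 h
          exact ⟨s, hs, hl, h⟩
        · obtain ⟨l, -, h⟩ := mem_iUnion₂.1 h
          obtain ⟨s, hs, h⟩ := mem_iUnion₂.1 h
          obtain ⟨-, h⟩ := mem_iUnion.1 h
          exact absurd (mem_iUnion₂.2 ⟨s, hs, h⟩) hxD
      choose s hsT hsl hxs using this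
      have : ∀ k, ∃ a, s (k + 1) = a :: s k := by
        intro k
        obtain ⟨a, t, hat⟩ := List.exists_cons_of_length_eq_add_one (hsl (k + 1))
        have hx' := hxs (k + 1)
        rw [hat] at hx'
        have hl := hsl (k + 1)
        rw [hat, List.length_cons] at hl
        exact ⟨a, by rw [hat, eq_of_mem_of_length_eq hP.antitone hP.disjoint
          (by rw [hsl]; omega) (hP.antitone t a hx') (hxs k)]⟩
      choose b hb using this
      have hres : ∀ k, PiNat.res b k = s k := by
        intro k
        induction k with
        | zero => exact (List.length_eq_zero_iff.1 (hsl 0)).symm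
        | succ k ih => rw [PiNat.res_succ, ih, hb]
      exact Or.inr ⟨b, fun k => by rw [hres]; exact ⟨hsT k, hxs k⟩⟩
  rw [this]
  refine isClosed_iInter fun k => (hlevel k P (fun s => (hP.isClopen s).isClosed)
    fun s => Subset.rfl).union ?_
  exact (finite_Iio k).isClosed_biUnion fun l _ => hlevel l _
    (fun s => hP.isClosed_net (hf s) (hd s)) hD

end Scheme

/-! ### Continuity of the coding -/

section Continuity

variable {X : Type u} {K : Type v} [PseudoMetricSpace K] {i : X → K} {P : List ℕ → Set X}
  {d : List ℕ → ℕ → Set X}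

theorem IsSchemeNet.exists_dist_lt_of_mem_treeSet (hd : IsSchemeNet i P d) {T : Set (List ℕ)}
    {x : X} (hx : x ∈ treeSet P d T) {ε : ℝ} (hε : 0 < ε) :
    ∃ y ∈ treeNet d T, dist (i x) (i y) < ε := by
  rcases hx with hx | ⟨b, hb⟩
  · exact ⟨x, hx, by simpa using hε⟩
  · obtain ⟨k, hk⟩ := exists_nat_one_div_lt hε
    obtain ⟨y, hy, hxy⟩ := hd.exists_dist_lt (PiNat.res b k) 0 x
      (mem_schemeTail (Nat.zero_le (b k)) (hb (k + 1)).2)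
    refine ⟨y, mem_iUnion₂.2 ⟨_, (hb k).1, mem_iUnion.2 ⟨0, hy⟩⟩, hxy.trans ?_⟩
    simpa using hk

/-- The lists of length at most `k` with entries at most `k`. -/
def boundedLists (k : ℕ) : Set (List ℕ) :=
  {s | s.length ≤ k ∧ ∀ a ∈ s, a ≤ k}

theorem finite_boundedLists (k : ℕ) : (boundedLists k).Finite := by
  refine ((List.finite_length_le (Fin (k + 1)) k).image (List.map Fin.val)).subset ?_
  rintro s ⟨hl, hs⟩
  refine ⟨s.map (Fin.ofNat (k + 1)), by simpa using hl, ?_⟩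
  rw [List.map_map]
  refine (List.map_congr_left fun a ha => ?_).trans (List.map_id s)
  exact Nat.mod_eq_of_lt (Nat.lt_succ_of_le (hs a ha))

/-- Let `t` be the last bounded node on the way from the root to `s`. The next step fails either by
length, and then `t.length = k` and `n = 0` works, or by an entry above `k`, and then `n = k` works.
In both cases the net `d t n` has error at most `1 / (k + 1)`. -/
theorem mem_boundedLists_or (hP : CantorScheme.Antitone P) {T : Set (List ℕ)} (hT : IsListTree T)
    (k : ℕ) : ∀ s ∈ T, s ∈ boundedLists k ∨
      ∃ t ∈ T, t ∈ boundedLists k ∧ ∃ n, k ≤ t.length + n ∧ P s ⊆ schemeTail P t n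
  | [], _ => Or.inl ⟨by simp, by simp⟩
  | a :: s, hs => by
    have hsT := hT.of_cons a s hs
    rcases mem_boundedLists_or hP hT k s hsT with h | ⟨t, ht, htb, n, hn, hsub⟩
    · by_cases hk : s.length = k
      · exact Or.inr ⟨s, hsT, h, 0, hk.ge, fun x hx => mem_schemeTail (Nat.zero_le a) hx⟩
      by_cases ha : a ≤ k
      · refine Or.inl ⟨?_, ?_⟩
        · rw [List.length_cons]
          have := h.1
          omega
        · rintro c (_ | ⟨_, hc⟩)
          · exact ha
          · exact h.2 c hc
      · exact Or.inr ⟨s, hsT, h, k, by omega, fun x hx => mem_schemeTail (by omega) hx⟩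
    · exact Or.inr ⟨t, ht, htb, n, hn, (hP s a).trans hsub⟩

/-- If two trees agree on sufficiently many lists, then the coded sets are close. -/
theorem IsSchemeNet.exists_dist_lt_of_agree (hd : IsSchemeNet i P d) (hP : CantorScheme.Antitone P)
    {T T' : Set (List ℕ)} (hT : IsListTree T) {k : ℕ}
    (h : ∀ s ∈ boundedLists k, s ∈ T → s ∈ T') {x : X} (hx : x ∈ treeNet d T) :
    ∃ y ∈ treeNet d T', dist (i x) (i y) < 1 / ((k : ℝ) + 1) := by
  obtain ⟨s, hs, hxs⟩ := mem_iUnion₂.1 hx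
  rcases mem_boundedLists_or hP hT k s hs with hsb | ⟨t, ht, htb, n, hn, hsub⟩
  · exact ⟨x, mem_iUnion₂.2 ⟨s, h s hsb hs, hxs⟩, by
      rw [dist_self]; exact Nat.one_div_pos_of_nat⟩
  · obtain ⟨m, hm⟩ := mem_iUnion.1 hxs
    obtain ⟨y, hy, hxy⟩ := hd.exists_dist_lt t n x
      (hsub (schemeTail_subset hP s m (hd.subset_tail s m hm)))
    exact ⟨y, mem_iUnion₂.2 ⟨t, h t htb ht, mem_iUnion.2 ⟨n, hy⟩⟩,
      hxy.trans_le (Nat.one_div_le_one_div hn)⟩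

end Continuity

theorem closure_subset_of_forall_exists_dist_lt {K : Type u} [PseudoMetricSpace K] {A B : Set K}
    {ε : ℝ} (hε : 0 < ε) (h : ∀ a ∈ A, ∃ b ∈ B, dist a b < ε / 2) :
    ∀ a ∈ closure A, ∃ b ∈ closure B, dist a b < ε := by
  intro a ha
  obtain ⟨a', ha', haa'⟩ := Metric.mem_closure_iff.1 ha (ε / 2) (half_pos hε)
  obtain ⟨b, hb, hab⟩ := h a' ha'
  exact ⟨b, subset_closure hb, by linarith [dist_triangle a a' b]⟩

/-- The closed set coded by a tree depends continuously on the tree. -/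
theorem continuous_closureIn_treeSet {X : Type u} [TopologicalSpace X] {K : Type v}
    [MetricSpace K] [CompactSpace K] {i : X → K} {P : List ℕ → Set X} {d : List ℕ → ℕ → Set X}
    (hP : CantorScheme.Antitone P) (hd : IsSchemeNet i P d) {S : Type w} [TopologicalSpace S]
    {T : S → Set (List ℕ)} (hT : ∀ x, IsListTree (T x))
    (hloc : ∀ x s, ∀ᶠ x' in 𝓝 x, (s ∈ T x' ↔ s ∈ T x))
    (hc : ∀ x, IsClosed (treeSet P d (T x))) :
    Continuous fun x => closureIn i ⟨treeSet P d (T x), hc x⟩ := by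
  have key : ∀ (ε : ℝ), 0 < ε → ∃ k : ℕ, ∀ x x', (∀ s ∈ boundedLists k, s ∈ T x → s ∈ T x') →
      ∀ a ∈ closure (i '' treeSet P d (T x)), ∃ b ∈ closure (i '' treeSet P d (T x')),
        dist a b < ε := by
    intro ε hε
    -- One `ε / 4` moves a point into the net, another passes to the net of the other tree; the
    -- remaining `ε / 2` pays for taking closures.
    obtain ⟨k, hk⟩ := exists_nat_one_div_lt (half_pos (half_pos hε))
    refine ⟨k, fun x x' hag => closure_subset_of_forall_exists_dist_lt hε ?_⟩
    rintro _ ⟨p, hp, rfl⟩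
    obtain ⟨q, hq, hpq⟩ := hd.exists_dist_lt_of_mem_treeSet hp (half_pos (half_pos hε))
    obtain ⟨r, hr, hqr⟩ := hd.exists_dist_lt_of_agree hP (hT x) hag hq
    exact ⟨i r, mem_image_of_mem i (Or.inl hr), by linarith [dist_triangle (i p) (i q) (i r)]⟩
  rw [continuous_iff_continuousAt]
  intro x
  rw [ContinuousAt, (nhds_basis_uniformity'
    (Metric.uniformity_basis_dist (α := K)).uniformity_compacts).tendsto_right_iff]
  intro ε hε
  obtain ⟨k, hk⟩ := key ε hε
  filter_upwards [(Filter.eventually_all_finite (finite_boundedLists k)).2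
    fun s _ => hloc x s] with x' hx'
  refine ⟨fun a ha => ?_, fun b hb => ?_⟩
  · exact hk x x' (fun s hs => (hx' s hs).2) a ha
  · obtain ⟨a, ha, hab⟩ := hk x' x (fun s hs => (hx' s hs).1) b hb
    exact ⟨a, ha, by rw [dist_comm] at hab; exact hab⟩

/-! ### Preimage trees and hardness -/

/-- The tree of attempts to find a preimage of `x` under `f`. -/
def preimageTree (f : (ℕ → ℕ) → ℕ → Bool) (x : ℕ → Bool) : Set (List ℕ) :=
  {s | ∃ c, PiNat.res c s.length = s ∧ ∀ j < s.length, f c j = x j}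

theorem isListTree_preimageTree (f : (ℕ → ℕ) → ℕ → Bool) (x : ℕ → Bool) :
    IsListTree (preimageTree f x) where
  nil_mem := ⟨0, rfl, fun j hj => absurd hj (Nat.not_lt_zero j)⟩
  of_cons := by
    rintro a s ⟨c, hc, h⟩
    rw [List.length_cons, PiNat.res_succ, List.cons.injEq] at hc
    exact ⟨c, hc.2, fun j hj => h j (hj.trans (Nat.lt_succ_self _))⟩

theorem eventually_mem_preimageTree_iff (f : (ℕ → ℕ) → ℕ → Bool) (x : ℕ → Bool) (s : List ℕ) :
    ∀ᶠ x' in 𝓝 x, (s ∈ preimageTree f x' ↔ s ∈ preimageTree f x) := by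
  have : ∀ᶠ x' in 𝓝 x, ∀ j ∈ Iio s.length, x' j = x j :=
    (Filter.eventually_all_finite (finite_Iio _)).2 fun j _ =>
      ((continuous_apply j).tendsto x).eventually_mem ((isOpen_discrete {x j}).mem_nhds rfl)
  filter_upwards [this] with x' hx'
  refine exists_congr fun c => and_congr_right fun _ => forall₂_congr fun j hj => ?_
  rw [hx' j hj]

/-- The witness `c k` may change with the node, but along a branch `b` the witnesses converge to `b`
and their values to `x`, so `f b = x` by continuity. -/
theorem exists_branch_preimageTree_iff {f : (ℕ → ℕ) → ℕ → Bool} (hf : Continuous f)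
    (x : ℕ → Bool) : (∃ b, ∀ k, PiNat.res b k ∈ preimageTree f x) ↔ x ∈ range f := by
  constructor
  · rintro ⟨b, hb⟩
    choose c hc hfc using hb
    simp only [PiNat.res_length] at hc hfc
    have hlim : Filter.Tendsto c Filter.atTop (𝓝 b) := by
      rw [tendsto_pi_nhds]
      intro j
      refine tendsto_const_nhds.congr' ?_
      filter_upwards [Filter.eventually_gt_atTop j] with k hk
      exact (PiNat.res_eq_res.1 (hc k) hk).symm
    have hlim' : Filter.Tendsto (fun k => f (c k)) Filter.atTop (𝓝 x) := by
      rw [tendsto_pi_nhds]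
      intro j
      refine tendsto_const_nhds.congr' ?_
      filter_upwards [Filter.eventually_gt_atTop j] with k hk
      exact (hfc k j hk).symm
    exact ⟨b, tendsto_nhds_unique ((hf.tendsto b).comp hlim) hlim'⟩
  · rintro ⟨b, rfl⟩
    exact ⟨b, fun k => ⟨b, by rw [PiNat.res_length], fun j _ => rfl⟩⟩

theorem IsClopenScheme.preimage_snd {Y : Type u} {Z : Type v} [TopologicalSpace Y]
    [TopologicalSpace Z] {N : List ℕ → Set Z} (hN : IsClopenScheme N) :
    IsClopenScheme fun s => (Prod.snd ⁻¹' N s : Set (Y × Z)) where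
  isClopen s := (hN.isClopen s).preimage continuous_snd
  antitone s a := preimage_mono (hN.antitone s a)
  disjoint s _ _ hab := (hN.disjoint s hab).preimage _
  locallyFinite s := (hN.locallyFinite s).preimage_continuous continuous_snd

theorem isCoanalyticHard_closedZeroDim {Y : Type u} [TopologicalSpace Y] [MetrizableSpace Y]
    {Z : Type v} [TopologicalSpace Z] [MetrizableSpace Z] [SeparableSpace Z]
    (hY : ¬ ZeroDimensional Y) (hZ : ZeroDimensional Z) (han : AnalyticSpace Z)
    (hns : ¬ SigmaCompactSpace Z) [t : TopologicalSpace (Closeds (Y × Z))]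
    (h_adm : IsAdmissible.{max u v, w} (Y × Z)) : IsCoanalyticHard (closedZeroDim (Y × Z)) := by
  obtain ⟨K, _, _, _, i, -, rfl⟩ := h_adm
  let := metrizableSpaceMetric K
  let : TopologicalSpace (Closeds (Y × Z)) := hyperspaceTopology i
  intro A hA
  rw [IsCoanalytic, AnalyticSet] at hA
  obtain hA | ⟨f, hf, hfA⟩ := hA
  -- Here `Aᶜ` is empty, hence not a range; a constant map to the empty closed set is a reduction.
  · refine ⟨fun _ => ⊥, continuous_const, ?_⟩
    rw [compl_empty_iff.1 hA]
    refine (eq_univ_of_forall fun _ => ?_).symm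
    have : Subsingleton ((⊥ : Closeds (Y × Z)) : Set (Y × Z)) := ⟨fun p => p.2.elim⟩
    exact ZeroDimensional.of_subsingleton
  obtain ⟨N, hN, hbranch⟩ := exists_isClopenScheme hZ han hns
  have hP := hN.preimage_snd (Y := Y)
  obtain ⟨d, hd⟩ := exists_isSchemeNet i fun s => (Prod.snd ⁻¹' N s : Set (Y × Z))
  have hc : ∀ x, IsClosed (treeSet _ d (preimageTree f x)) := fun x =>
    hP.isClosed_treeSet hd.finite hd.subset_tail (isListTree_preimageTree f x)
  refine ⟨fun x => ⟨_, hc x⟩, continuous_induced_rng.2 (continuous_closureIn_treeSet hP.antitone hd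
    (isListTree_preimageTree f) (eventually_mem_preimageTree_iff f) hc), ?_⟩
  ext x
  rw [← not_iff_not, ← mem_compl_iff, ← hfA, ← exists_branch_preimageTree_iff hf]
  constructor
  · rintro ⟨b, hb⟩ hx
    obtain ⟨z, hz⟩ := hbranch b
    refine hY (ZeroDimensional.of_isInducing hx
      (f := fun y => ⟨(y, z), Or.inr ⟨b, fun k => ⟨hb k, hz k⟩⟩⟩) ?_)
    exact IsInducing.subtypeVal.of_comp_iff.1 (isEmbedding_prodMkLeft z).isInducing
  · intro hx
    by_contra hb
    refine hx ?_
    have hcount : (treeSet (fun s => (Prod.snd ⁻¹' N s : Set (Y × Z))) d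
        (preimageTree f x)).Countable := by
      refine Countable.union ?_ ((countable_empty).mono ?_)
      · exact (to_countable _).biUnion fun s _ => countable_iUnion fun n => (hd.finite s n).countable
      · rintro p ⟨b, h⟩
        exact hb ⟨b, fun k => (h k).1⟩
    have := hcount.to_subtype
    exact ZeroDimensional.of_countable

/-! ### The coanalytic upper bound -/

theorem ZeroDimensional.subsingleton {X : Type u} [TopologicalSpace X] [T1Space X]
    [PreconnectedSpace X] (hX : ZeroDimensional X) : Subsingleton X := by
  rw [zeroDimensional_iff_exists_isClopen] at hX
  refine ⟨fun a b => ?_⟩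
  by_contra hab
  obtain ⟨V, hV, haV, hVb⟩ := hX a {b}ᶜ isOpen_compl_singleton hab
  rcases isClopen_iff.1 hV with rfl | rfl
  · exact haV
  · exact hVb (mem_univ b) rfl

/-- A closed subset of the product of a `σ`-compact space with a zero-dimensional space fails to be
zero-dimensional exactly if some fibre contains a nontrivial continuum. -/
theorem not_zeroDimensional_iff_exists_continuum {Y : Type u} [TopologicalSpace Y]
    [MetrizableSpace Y] [SeparableSpace Y] {Z : Type v} [TopologicalSpace Z] [MetrizableSpace Z]
    [SeparableSpace Z] (hZ : ZeroDimensional Z) {Q : ℕ → Set Y} (hQ : ∀ n, IsCompact (Q n))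
    (hcov : (⋃ n, Q n) = univ) (F : Closeds (Y × Z)) :
    ¬ ZeroDimensional (F : Set (Y × Z)) ↔ ∃ (n : ℕ) (C : Compacts (Q n)) (z : Z),
      IsPreconnected (C : Set (Q n)) ∧ (C : Set (Q n)).Nontrivial ∧
        ∀ c ∈ C, ((c : Y), z) ∈ F := by
  constructor
  · intro hF
    by_contra hno
    refine hF ?_
    let := metrizableSpaceMetric Y
    let := metrizableSpaceMetric Z
    have : SecondCountableTopology Y := UniformSpace.secondCountable_of_separable Y
    have : SecondCountableTopology Z := UniformSpace.secondCountable_of_separable Z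
    refine ZeroDimensional.of_iUnion_isClosed (fun n => {p : (F : Set (Y × Z)) | p.1.1 ∈ Q n})
      (fun n => (hQ n).isClosed.preimage (continuous_fst.comp continuous_subtype_val))
      (fun n => ?_) (eq_univ_of_forall fun p => ?_)
    · have := isCompact_iff_compactSpace.1 (hQ n)
      let e : {p : (F : Set (Y × Z)) | p.1.1 ∈ Q n} → Q n × Z :=
        fun x => (⟨x.1.1.1, x.2⟩, x.1.1.2)
      have he : IsClosedEmbedding e := by
        refine ⟨?_, ?_⟩
        · exact IsEmbedding.of_comp (g := Prod.map ((↑) : Q n → Y) (id : Z → Z)) (by fun_prop)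
            (by fun_prop) (IsEmbedding.subtypeVal.comp IsEmbedding.subtypeVal)
        · have : range e = (fun q : Q n × Z => ((q.1 : Y), q.2)) ⁻¹' (F : Set (Y × Z)) := by
            ext q
            constructor
            · rintro ⟨x, rfl⟩
              exact x.1.2
            · intro hq
              exact ⟨⟨⟨_, hq⟩, q.1.2⟩, rfl⟩
          rw [this]
          exact F.isClosed.preimage (by fun_prop)
      refine hZ.of_isProperMap (isProperMap_snd_of_compactSpace.comp he.isProperMap) fun z => ?_
      intro t htz ht a ha b hb
      by_contra hab
      -- A connected set with two points in the fibre over `z` projects injectively to `Q n`; the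
      -- closure of its image is the forbidden continuum.
      refine hno ⟨n, ⟨closure ((Prod.fst ∘ e) '' t), isClosed_closure.isCompact⟩, z,
        (ht.image _ (continuous_fst.comp he.continuous).continuousOn).closure,
        ⟨_, subset_closure (mem_image_of_mem _ ha), _, subset_closure (mem_image_of_mem _ hb),
          fun h => hab (he.injective (Prod.ext h ?_))⟩, ?_⟩
      · exact (htz ha).trans (htz hb).symm
      · have hcl : IsClosed {c : Q n | ((c : Y), z) ∈ F} := F.isClosed.preimage (by fun_prop)
        refine fun c hc => closure_minimal ?_ hcl hc
        rintro _ ⟨x, hx, rfl⟩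
        have : x.1.1.2 = z := htz hx
        subst this
        exact x.1.2
    · obtain ⟨n, hn⟩ := mem_iUnion.1 (hcov ▸ mem_univ p.1.1 : p.1.1 ∈ ⋃ n, Q n)
      exact mem_iUnion.2 ⟨n, hn⟩
  · rintro ⟨n, C, z, hC, ⟨a, ha, b, hb, hab⟩, hCF⟩ hF
    have : PreconnectedSpace (C : Set (Q n)) := isPreconnected_iff_preconnectedSpace.1 hC
    have hC0 : ZeroDimensional (C : Set (Q n)) := by
      refine hF.of_isInducing
        (f := fun c => (⟨((c : Q n), z), hCF c c.2⟩ : (F : Set (Y × Z)))) ?_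
      refine (IsInducing.subtypeVal.of_comp_iff).1 ?_
      exact (isEmbedding_prodMkLeft z).isInducing.comp
        (IsInducing.subtypeVal.comp IsInducing.subtypeVal)
    have := hC0.subsingleton
    exact hab (congrArg Subtype.val (Subsingleton.elim (⟨a, ha⟩ : (C : Set (Q n))) ⟨b, hb⟩))

/-- If `C` splits into two parts inside disjoint open sets `U` and `V`, then any compact set close
to `C` lies in `U ∪ V` and meets both. -/
theorem isClosed_isPreconnected_compacts {Q : Type u} [TopologicalSpace Q] [T2Space Q] :
    IsClosed {C : Compacts Q | IsPreconnected (C : Set Q)} := by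
  rw [← isOpen_compl_iff, isOpen_iff_mem_nhds]
  intro C hC
  rw [mem_compl_iff, mem_ofPred_eq, isPreconnected_closed_iff] at hC
  push Not at hC
  obtain ⟨s, t, hs, ht, hst, hCs, hCt, hd⟩ := hC
  obtain ⟨U, V, hU, hV, hsU, htV, hUV⟩ := SeparatedNhds.of_isCompact_isCompact
    (C.isCompact.inter_right hs) (C.isCompact.inter_right ht)
    (disjoint_left.2 fun x hx hx' => (hd ▸ ⟨hx.1, hx.2, hx'.2⟩ : x ∈ (∅ : Set Q)))
  filter_upwards [(Compacts.isOpen_subsets_of_isOpen (hU.union hV)).mem_nhds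
      (fun x hx => (hst hx).imp (fun h => hsU ⟨hx, h⟩) fun h => htV ⟨hx, h⟩),
    (Compacts.isOpen_inter_nonempty_of_isOpen hU).mem_nhds (hCs.mono fun x hx => ⟨hx.1, hsU hx⟩),
    (Compacts.isOpen_inter_nonempty_of_isOpen hV).mem_nhds (hCt.mono fun x hx => ⟨hx.1, htV hx⟩)]
    with D h1 h2 h3 hD
  obtain ⟨x, -, hxU, hxV⟩ := hD U V hU hV h1 h2 h3
  exact disjoint_left.1 hUV hxU hxV

theorem isOpen_nontrivial_compacts {Q : Type u} [TopologicalSpace Q] [T2Space Q] :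
    IsOpen {C : Compacts Q | (C : Set Q).Nontrivial} := by
  rw [isOpen_iff_mem_nhds]
  rintro C ⟨a, ha, b, hb, hab⟩
  obtain ⟨U, V, hU, hV, haU, hbV, hUV⟩ := t2_separation hab
  filter_upwards [(Compacts.isOpen_inter_nonempty_of_isOpen hU).mem_nhds ⟨a, ha, haU⟩,
    (Compacts.isOpen_inter_nonempty_of_isOpen hV).mem_nhds ⟨b, hb, hbV⟩] with D h1 h2
  obtain ⟨x, hx, hxU⟩ := h1
  obtain ⟨y, hy, hyV⟩ := h2
  exact ⟨x, hx, y, hy, fun h => disjoint_left.1 hUV hxU (h ▸ hyV)⟩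

theorem isClosed_le_compacts {K : Type u} [TopologicalSpace K] [T2Space K] :
    IsClosed {p : Compacts K × Compacts K | p.1 ≤ p.2} := by
  simp_rw [← sup_eq_right]
  exact isClosed_eq (by fun_prop) continuous_snd

theorem AnalyticSpace.of_sigmaCompactSpace {Y : Type u} [TopologicalSpace Y] [MetrizableSpace Y]
    [SigmaCompactSpace Y] : AnalyticSpace Y := by
  let := metrizableSpaceMetric Y
  rw [AnalyticSpace, ← iUnion_compactCovering]
  refine AnalyticSet.iUnion fun n => ?_
  have := isCompact_iff_compactSpace.1 (isCompact_compactCovering Y n)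
  rw [← Subtype.range_coe (s := compactCovering Y n)]
  exact analyticSet_range_of_polishSpace continuous_subtype_val

theorem AnalyticSpace.exists_continuous_surjective {X : Type u} [TopologicalSpace X] [Nonempty X]
    (hX : AnalyticSpace X) : ∃ g : (ℕ → ℕ) → X, Continuous g ∧ Function.Surjective g := by
  rw [AnalyticSpace, AnalyticSet] at hX
  obtain h | ⟨g, hg, hgr⟩ := hX
  · exact absurd h univ_nonempty.ne_empty
  · exact ⟨g, hg, range_eq_univ.1 hgr⟩

theorem polishSpace_of_compactSpace {X : Type u} [TopologicalSpace X] [CompactSpace X]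
    [MetrizableSpace X] : PolishSpace X := by
  let := metrizableSpaceMetric X
  infer_instance

theorem polishSpace_prod {A : Type u} {B : Type v} [TopologicalSpace A] [PolishSpace A]
    [TopologicalSpace B] [PolishSpace B] : PolishSpace (A × B) :=
  inferInstance

/-- The pairs consisting of a compact set and a sequence that is dense in it, relative to a
continuous parametrization `e` of the points of the sequence. -/
theorem measurableSet_dense_seq {K : Type u} [TopologicalSpace K] [SecondCountableTopology K]
    [T2Space K] {B : Type v} [TopologicalSpace B] {e : B → K} (he : Continuous e) {P : Type w}
    [TopologicalSpace P] [MeasurableSpace P] [BorelSpace P] {L : P → Compacts K}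
    (hL : Continuous L) {x : P → ℕ → B} (hx : Continuous x) :
    MeasurableSet {p | (∀ k, e (x p k) ∈ L p) ∧
      (L p : Set K) ⊆ closure (range fun k => e (x p k))} := by
  have hxk : ∀ k, Continuous fun p => e (x p k) := fun k =>
    he.comp ((continuous_apply k).comp hx)
  -- Density is tested on a countable basis, where meeting a basic open set is an open condition on
  -- `L p`.
  have h : {p | (∀ k, e (x p k) ∈ L p) ∧
      (L p : Set K) ⊆ closure (range fun k => e (x p k))} =
      (⋂ k, {p | ({e (x p k)} : Compacts K) ≤ L p}) ∩
      ⋂ U ∈ countableBasis K, ({p | ((L p : Set K) ∩ U).Nonempty}ᶜ ∪ ⋃ k, {p | e (x p k) ∈ U}) := by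
    ext p
    refine and_congr ?_ ?_
    · simp only [mem_iInter, mem_ofPred_eq]
      exact forall_congr' fun k => by
        rw [← SetLike.coe_subset_coe, Compacts.coe_singleton, singleton_subset_iff]; rfl
    · simp only [mem_iInter, mem_union, mem_compl_iff, mem_ofPred_eq, mem_iUnion]
      constructor
      · intro h U hU
        rw [← imp_iff_not_or]
        rintro ⟨y, hy, hyU⟩
        obtain ⟨_, hz, k, rfl⟩ := mem_closure_iff.1 (h hy) U
          (isOpen_of_mem_countableBasis hU) hyU
        exact ⟨k, hz⟩
      · intro h y hy
        refine (isBasis_countableBasis K).mem_closure_iff.2 fun U hU hyU => ?_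
        obtain ⟨k, hk⟩ := (h U hU).resolve_left fun hn => hn ⟨y, hy, hyU⟩
        exact ⟨_, hk, k, rfl⟩
  rw [h]
  refine MeasurableSet.inter (MeasurableSet.iInter fun k => ?_)
    (MeasurableSet.biInter (countable_countableBasis K) fun U hU => MeasurableSet.union ?_
      (MeasurableSet.iUnion fun k => ?_))
  · exact (isClosed_le_compacts.preimage
      ((Compacts.continuous_singleton.comp (hxk k)).prodMk hL)).measurableSet
  · exact ((Compacts.isOpen_inter_nonempty_of_isOpen
      (isOpen_of_mem_countableBasis hU)).preimage hL).measurableSet.compl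
  · exact ((isOpen_of_mem_countableBasis hU).preimage (hxk k)).measurableSet

theorem isCoanalytic_closedZeroDim {Y : Type u} [TopologicalSpace Y] [MetrizableSpace Y]
    [SeparableSpace Y] [SigmaCompactSpace Y]
    {Z : Type v} [TopologicalSpace Z] [MetrizableSpace Z] [SeparableSpace Z]
    (hZ : ZeroDimensional Z) (han : AnalyticSpace Z) [t : TopologicalSpace (Closeds (Y × Z))]
    (h_adm : IsAdmissible.{max u v, w} (Y × Z)) : IsCoanalytic (closedZeroDim (Y × Z)) := by
  obtain ⟨K, _, _, _, i, hi, rfl⟩ := h_adm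
  let : TopologicalSpace (Closeds (Y × Z)) := hyperspaceTopology i
  let := metrizableSpaceMetric K
  let := metrizableSpaceMetric Y
  let := metrizableSpaceMetric Z
  have : SecondCountableTopology Y := UniformSpace.secondCountable_of_separable Y
  have : SecondCountableTopology Z := UniformSpace.secondCountable_of_separable Z
  have hYan := AnalyticSpace.of_sigmaCompactSpace (Y := Y)
  rw [IsCoanalytic]
  rcases isEmpty_or_nonempty (Y × Z) with hemp | hne
  · convert analyticSet_empty
    refine compl_empty_iff.2 (eq_univ_of_forall fun F => ?_)
    have : Subsingleton (F : Set (Y × Z)) := inferInstance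
    exact ZeroDimensional.of_subsingleton
  have : Nonempty Y := hne.map Prod.fst
  have : Nonempty Z := hne.map Prod.snd
  obtain ⟨gY, hgY, hgYs⟩ := hYan.exists_continuous_surjective
  obtain ⟨gZ, hgZ, hgZs⟩ := han.exists_continuous_surjective
  let g : (ℕ → ℕ) × (ℕ → ℕ) → Y × Z := Prod.map gY gZ
  have hg : Continuous g := hgY.prodMap hgZ
  have hgs : Function.Surjective g := hgYs.prodMap hgZs
  let Q := compactCovering Y
  have hQ : ∀ n, CompactSpace (Q n) := fun n =>
    isCompact_iff_compactSpace.1 (isCompact_compactCovering Y n)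
  let G : Compacts K → Closeds (Y × Z) := fun L =>
    ⟨i ⁻¹' L, L.isCompact.isClosed.preimage hi.continuous⟩
  -- Not every compact subset of `K` is the closure of a subset of `i(Y × Z)`. The coded dense
  -- sequence certifies this for the first component, so that `G` followed by `closureIn i` is the
  -- identity there, which makes `G` continuous on `W n`.
  let W : (n : ℕ) → Set (Compacts K × (ℕ → (ℕ → ℕ) × (ℕ → ℕ)) × (ℕ → ℕ) × Compacts (Q n)) :=
    fun n => {p | ((∀ k, i (g (p.2.1 k)) ∈ p.1) ∧
        (p.1 : Set K) ⊆ closure (range fun k => i (g (p.2.1 k)))) ∧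
      (p.2.2.2 ×ˢ ({gZ p.2.2.1} : Compacts Z)).map (fun q => i (q.1, q.2))
        (hi.continuous.comp (by fun_prop)) ≤ p.1 ∧
      IsPreconnected (p.2.2.2 : Set (Q n)) ∧ (p.2.2.2 : Set (Q n)).Nontrivial}
  have hW4 : ∀ n (L : Compacts K) (C : Compacts (Q n)) (z : Z),
      ((C ×ˢ ({z} : Compacts Z)).map (fun q => i (q.1, q.2))
        (hi.continuous.comp (by fun_prop)) ≤ L ↔ ∀ c ∈ C, i ((c : Y), z) ∈ L) := by
    intro n L C z
    rw [← SetLike.coe_subset_coe, Compacts.coe_map, Compacts.coe_prod, Compacts.coe_singleton,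
      image_subset_iff]
    constructor
    · exact fun h c hc => h (show (c, z) ∈ (C : Set (Q n)) ×ˢ {z} from ⟨hc, rfl⟩)
    · rintro h ⟨c, z'⟩ ⟨hc, hz⟩
      rw [mem_singleton_iff] at hz
      dsimp only at hz
      subst hz
      exact h c hc
  have hcl : ∀ n, ∀ p ∈ W n, closureIn i (G p.1) = p.1 := by
    rintro n ⟨L, x, v, C⟩ ⟨⟨h1, h2⟩, -⟩
    refine SetLike.coe_injective (Subset.antisymm ?_ ?_)
    · exact closure_minimal (image_preimage_subset _ _) L.isCompact.isClosed
    · refine h2.trans (closure_mono ?_)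
      rintro _ ⟨k, rfl⟩
      exact ⟨_, h1 k, rfl⟩
  have key : (closedZeroDim (Y × Z))ᶜ = ⋃ n, (fun p => G p.1) '' W n := by
    ext F
    rw [mem_compl_iff, closedZeroDim, mem_ofPred_eq,
      not_zeroDimensional_iff_exists_continuum hZ (isCompact_compactCovering Y)
        (iUnion_compactCovering Y), mem_iUnion]
    refine exists_congr fun n => ?_
    constructor
    · rintro ⟨C, z, hC, hCn, hCF⟩
      obtain ⟨c, hc⟩ := hCn.nonempty
      have : Nonempty (F : Set (Y × Z)) := ⟨⟨_, hCF c hc⟩⟩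
      obtain ⟨y, hy⟩ := exists_dense_seq (F : Set (Y × Z))
      choose x hx using fun k => hgs (y k)
      obtain ⟨v, rfl⟩ := hgZs z
      refine ⟨(closureIn i F, x, v, C), ⟨⟨fun k => ?_, ?_⟩, ?_, hC, hCn⟩, ?_⟩
      · exact subset_closure ⟨y k, (y k).2, by rw [hx]⟩
      · refine closure_minimal ?_ isClosed_closure
        rintro _ ⟨p, hp, rfl⟩
        have := hy.closure_eq ▸ mem_univ (⟨p, hp⟩ : (F : Set (Y × Z)))
        have hcont : Continuous fun q : (F : Set (Y × Z)) => i q :=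
          hi.continuous.comp continuous_subtype_val
        refine closure_mono ?_ (image_closure_subset_closure_image hcont ⟨_, this, rfl⟩)
        rintro _ ⟨_, ⟨k, rfl⟩, rfl⟩
        exact ⟨k, by simp only [hx]⟩
      · exact (hW4 n _ C _).2 fun c hc => subset_closure ⟨_, hCF c hc, rfl⟩
      · refine SetLike.coe_injective ?_
        change i ⁻¹' closure (i '' F) = F
        rw [← hi.closure_eq_preimage_closure_image, F.isClosed.closure_eq]
    · rintro ⟨⟨L, x, v, C⟩, ⟨-, hL, hC, hCn⟩, rfl⟩
      exact ⟨C, gZ v, hC, hCn, (hW4 n L C _).1 hL⟩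
  rw [key]
  refine AnalyticSet.iUnion fun n => AnalyticSet.image_of_continuousOn ?_ ?_
  · let : MeasurableSpace (Compacts K × (ℕ → (ℕ → ℕ) × (ℕ → ℕ)) × (ℕ → ℕ) × Compacts (Q n)) :=
      borel _
    have : BorelSpace (Compacts K × (ℕ → (ℕ → ℕ) × (ℕ → ℕ)) × (ℕ → ℕ) × Compacts (Q n)) := ⟨rfl⟩
    have : PolishSpace (Compacts K) := polishSpace_of_compactSpace
    have : PolishSpace (Compacts (Q n)) := polishSpace_of_compactSpace
    have : PolishSpace ((ℕ → ℕ) × Compacts (Q n)) := polishSpace_prod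
    have : PolishSpace ((ℕ → (ℕ → ℕ) × (ℕ → ℕ)) × (ℕ → ℕ) × Compacts (Q n)) := polishSpace_prod
    have : PolishSpace (Compacts K × (ℕ → (ℕ → ℕ) × (ℕ → ℕ)) × (ℕ → ℕ) × Compacts (Q n)) :=
      polishSpace_prod
    refine MeasurableSet.analyticSet ?_
    refine (measurableSet_dense_seq (hi.continuous.comp hg) continuous_fst
      (continuous_fst.comp continuous_snd)).inter (MeasurableSet.inter ?_ (MeasurableSet.inter ?_ ?_))
    · refine (isClosed_le_compacts.preimage (Continuous.prodMk ?_ continuous_fst)).measurableSet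
      refine (Continuous.compacts_map (hi.continuous.comp (by fun_prop))).comp ?_
      exact Compacts.continuous_prod.comp
        ((continuous_snd.comp (continuous_snd.comp continuous_snd)).prodMk
          (Compacts.continuous_singleton.comp
            (hgZ.comp (continuous_fst.comp (continuous_snd.comp continuous_snd)))))
    · exact (isClosed_isPreconnected_compacts.preimage
        (continuous_snd.comp (continuous_snd.comp continuous_snd))).measurableSet
    · exact (isOpen_nontrivial_compacts.preimage
        (continuous_snd.comp (continuous_snd.comp continuous_snd))).measurableSet
  · rw [continuousOn_iff_continuous_domRestrict]
    refine continuous_induced_rng.2 ?_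
    refine (continuous_fst.comp continuous_subtype_val).congr fun p => ?_
    exact (hcl n p.1 p.2).symm

theorem mainTheorem8
    (Y : Type u) [TopologicalSpace Y] [MetrizableSpace Y] [SeparableSpace Y]
    (Z : Type v) [TopologicalSpace Z] [MetrizableSpace Z] [SeparableSpace Z]
    (hY : ¬ ZeroDimensional Y)
    (hZ_zero : ZeroDimensional Z) (hZ_an : AnalyticSpace Z) (hZ : ¬ SigmaCompactSpace Z)
    [TopologicalSpace (Closeds (Y × Z))] (h_adm : IsAdmissible.{max u v, w} (Y × Z)) :
    (AnalyticSpace Y → IsCoanalyticHard (closedZeroDim (Y × Z))) ∧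
    (SigmaCompactSpace Y → IsCoanalyticComplete (closedZeroDim (Y × Z))) := by
  have hard := isCoanalyticHard_closedZeroDim hY hZ_zero hZ_an hZ h_adm
  exact ⟨fun _ => hard, fun _ => ⟨isCoanalytic_closedZeroDim hZ_zero hZ_an h_adm, hard⟩⟩
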